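/- Two-hop underlay relaying: let $h_{SR},h_{SP},h_{RD},h_{RP}$ be the complex channel coefficients of four links, and for each link $c$ let $m_c\ge \tfrac12$, $k_c>0$, $d_c>0$, $\alpha_c\in\mathbb R$ and $\Omega_c=d_c^{-\alpha_c}$. Assume that the amplitude $|h_c|$ has the generalized-$K$ distribution with multipath parameter $m_c$, shadowing parameter $k_c$ and mean power $\Omega_c$, i.e. has the density $$\frac{4\,(k_cm_c/\Omega_c)^{(k_c+m_c)/2}}{\Gamma(m_c)\Gamma(k_c)}\,r^{k_c+m_c-1}K_{k_c-m_c}\!\Big(2\sqrt{k_cm_c/\Omega_c}\;r\Big),\qquad r>0,$$ where $K_\nu(x)=\int_0^\infty e^{-x\cosh t}\cosh(\nu t)\,dt$ is the modified Bessel function of the second kind. For hop $l\in\{1,2\}$ put $(i,j)=(SR,SP)$ if $l=1$ and $(i,j)=(RD,RP)$ if $l=2$, and assume that $|h_i|^2$ and $|h_j|^2$ are independent. For $w,N_0>0$ let $$\gamma_l=\frac{w\,|h_i|^2}{N_0\,|h_j|^2},\qquad \mathcal M_{\gamma_l}(s)=\mathbb E\big[e^{-s\gamma_l}\big],\qquad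 \Delta=\frac{k_i+m_i}{2},\quad \Theta=\frac{k_i-m_i}{2},\quad C=\frac{k_im_i\Omega_jN_0}{k_jm_j\Omega_iw}.$$ Then $\mathcal M_{\gamma_l}$ is differentiable at every real $s>0$, and $$\frac{\partial}{\partial s}\mathcal M_{\gamma_l}(s)=-\frac{C^{\Delta}}{\Gamma(m_i)\Gamma(m_j)\Gamma(k_i)\Gamma(k_j)\,s^{\Delta+1}}\;G^{2,3}_{3,2}\!\left[\frac{C}{s}\;\middle|\;\begin{array}{c}-\Delta,\;1-\Delta-k_j,\;1-\Delta-m_j\\ \Theta,\;-\Theta\end{array}\right],$$ where $G^{2,3}_{3,2}$ is the Meijer $G$-function, $$G^{2,3}_{3,2}\!\left[z\;\middle|\;\begin{array}{c}a_1,a_2,a_3\\ b_1,b_2\end{array}\right]=\frac1{2\pi \mathrm i}\int_{\sigma-\mathrm i\infty}^{\sigma+\mathrm i\infty}\Gamma(b_1-t)\Gamma(b_2-t)\prod_{r=1}^{3}\Gamma(1-a_r+t)\;z^t\,dt,$$ the line $\operatorname{Re}t=\sigma$ separating the poles of $\Gamma(b_1-t)\Gamma(b_2-t)$ (to its right) from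 those of $\prod_{r}\Gamma(1-a_r+t)$ (to its left). -/

import Mathlib

open MeasureTheory ProbabilityTheory

noncomputable section

/-- The four wireless links: source to relay, source to primary node, relay to destination, and
relay to primary node. -/
inductive Channel
  | SR
  | SP
  | RD
  | RP

/-- The two hops of the relayed transmission. -/
inductive Hop
  | first
  | second

/-- The secondary (information-carrying) link `i` of a hop: `SR` for the first hop, `RD` for the
second. -/
def Hop.secondary : Hop → Channel
  | .first => .SR
  | .second => .RD

/-- The link `j` to the primary node of a hop: `SP` for the first hop, `RP` for the second. -/
def Hop.primary : Hop → Channel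
  | .first => .SP
  | .second => .RP

/-- The modified Bessel function of the second kind of real order `ν`, for `0 < x`:
`K_ν(x) = ∫_0^∞ exp (-x cosh t) cosh (ν t) dt`. -/
def besselK (ν x : ℝ) : ℝ :=
  ∫ t in Set.Ioi (0 : ℝ), Real.exp (-x * Real.cosh t) * Real.cosh (ν * t)

/-- The density of a generalized-`K` distributed amplitude with multipath parameter `m`, shadowing
parameter `k` and mean power `P`. -/
def generalizedKPDF (m k P r : ℝ) : ℝ :=
  if 0 < r then
    4 * (k * m / P) ^ ((k + m) / 2) / (Real.Gamma m * Real.Gamma k) * r ^ (k + m - 1) *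
      besselK (k - m) (2 * Real.sqrt (k * m / P) * r)
  else 0

/-- The generalized-`K` distribution (of an amplitude). -/
def generalizedKMeasure (m k P : ℝ) : Measure ℝ :=
  volume.withDensity (fun r => ENNReal.ofReal (generalizedKPDF m k P r))

/-- The integrand of the Mellin-Barnes integral of the Meijer function `G^{m,n}_{p,q}`:
`∏_{j ≤ m} Γ(b_j - t) ∏_{j ≤ n} Γ(1 - a_j + t) z^t` divided by
`∏_{m < j ≤ q} Γ(1 - b_j + t) ∏_{n < j ≤ p} Γ(a_j - t)`. -/
def meijerGIntegrand (m n : ℕ) {p q : ℕ} (a : Fin p → ℂ) (b : Fin q → ℂ) (z t : ℂ) : ℂ :=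
  (∏ j : Fin q, if j.val < m then Complex.Gamma (b j - t)
      else (Complex.Gamma (1 - b j + t))⁻¹) *
    (∏ j : Fin p, if j.val < n then Complex.Gamma (1 - a j + t)
      else (Complex.Gamma (a j - t))⁻¹) *
    z ^ t

/-- The vertical line `Re t = σ` separates the poles of `Γ(b_j - t)`, `j ≤ m` (to its right), from
those of `Γ(1 - a_j + t)`, `j ≤ n` (to its left). -/
def SeparatesPoles (m n : ℕ) {p q : ℕ} (a : Fin p → ℂ) (b : Fin q → ℂ) (σ : ℝ) : Prop :=
  (∀ j : Fin p, j.val < n → (a j).re - 1 < σ) ∧ (∀ j : Fin q, j.val < m → σ < (b j).re)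

open Classical in
/-- The Meijer function `G^{m,n}_{p,q}[z | a ; b]`, that is, `1 / (2 π i)` times the integral of
`meijerGIntegrand` from `σ - i ∞` to `σ + i ∞` along a line that separates the two families of
poles. This covers the parameters for which such a line exists and, by the usual convergence
criterion, `p + q < 2 (m + n)` and `|arg z| < (m + n - (p + q) / 2) π`; the value does not depend
on the line. Where no such line exists the value is set to `0`. -/
def meijerG (m n : ℕ) {p q : ℕ} (a : Fin p → ℂ) (b : Fin q → ℂ) (z : ℂ) : ℂ :=
  if h : ∃ σ : ℝ, SeparatesPoles m n a b σ then
    1 / (2 * Real.pi) *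
      ∫ y : ℝ, meijerGIntegrand m n a b z ((h.choose : ℂ) + (y : ℂ) * Complex.I)
  else 0

/-- The signal-to-noise ratio `γ_l = w |h_i|² / (N₀ |h_j|²)` of hop `l`. -/
def hopSNR {S : Type*} (h : Channel → S → ℂ) (w N₀ : ℝ) (l : Hop) (x : S) : ℝ :=
  w * ‖h l.secondary x‖ ^ 2 / (N₀ * ‖h l.primary x‖ ^ 2)

/-- The moment generating function `s ↦ E[exp(-s X)]`, with the sign convention of the Laplace
transform. -/
def negMGF {S : Type*} [MeasurableSpace S] (X : S → ℝ) (μ : Measure S) (s : ℝ) : ℝ :=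
  ∫ x, Real.exp (-s * X x) ∂μ

/-- `Δ = (k + m) / 2` -/
def halfSum (k m : ℝ) : ℝ := (k + m) / 2

/-- `Θ = (k - m) / 2` -/
def halfDiff (k m : ℝ) : ℝ := (k - m) / 2

/-- `Ω = d ^ (-α)`, the mean channel power at normalized distance `d` with path loss factor `α`. -/
def pathGain (d α : ℝ) : ℝ := d ^ (-α)

end

/-! Differentiating under the expectation gives `-E[γ e^{-sγ}]`. Mellin inversion of the Gamma
integral writes `e^{-sγ}` as a vertical-line integral of `Γ(u) (sγ)^{-u}`, and Fubini leaves the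
complex moments `E[γ^{1-u}]` (`integral_mul_exp_neg_eq`). By independence each moment is a product
of moments of the two channel powers, and each factor is a Mellin transform of a Bessel function,
hence a product of two Gamma values (`integral_cpow_generalizedK`, `integral_ratio_cpow`).

With `u = 1 + Δ + t`, the Gamma factor of the exponential and the four from the moments are exactly
the five factors of the Meijer integrand. The conditions for Mellin inversion and for the moment to
exist are together the separation of poles, so the argument works on whichever separating line the
definition of `meijerG` selects.

The Bessel Mellin transform comes from integrating out `r` first, which leaves a hyperbolic form of
the Beta integral. -/

/-! ### Gamma on vertical lines and Mellin inversion of the exponential. -/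

theorem norm_Gamma_le_Gamma_re {s : ℂ} (hs : 0 < s.re) : ‖Complex.Gamma s‖ ≤ Real.Gamma s.re := by
  rw [Complex.Gamma_eq_integral hs, Real.Gamma_eq_integral hs, Complex.GammaIntegral]
  refine (norm_integral_le_integral_norm _).trans (le_of_eq ?_)
  refine setIntegral_congr_fun measurableSet_Ioi fun x hx => ?_
  simp only [norm_mul, Complex.norm_real, Real.norm_eq_abs, abs_of_pos (Real.exp_pos _)]
  rw [Complex.norm_cpow_eq_rpow_re_of_pos hx]
  simp

theorem continuous_Gamma_vertical {τ : ℝ} (hτ : 0 < τ) :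
    Continuous fun y : ℝ => Complex.Gamma (τ + y * Complex.I) := by
  refine continuous_iff_continuousAt.2 fun y => ?_
  have h1 : ContinuousAt Complex.Gamma (τ + y * Complex.I) := by
    refine (Complex.differentiableAt_Gamma _ fun n hn => ?_).continuousAt
    have := congrArg Complex.re hn
    simp at this
    have hn0 : (0 : ℝ) ≤ n := n.cast_nonneg
    linarith
  exact ContinuousAt.comp (f := fun y : ℝ => (τ + y * Complex.I : ℂ)) h1
    (Continuous.continuousAt (by fun_prop))

/-- Quadratic decay is enough: in `Γ(s) = Γ(s+2) / (s(s+1))` the numerator is bounded on the line by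
`Γ(τ+2)`, and `|s(s+1)| ≥ |s|² = τ² + y²`. -/
theorem verticalIntegrable_Gamma {τ : ℝ} (hτ : 0 < τ) :
    Complex.VerticalIntegrable Complex.Gamma τ := by
  have hint : Integrable fun y : ℝ => Real.Gamma (τ + 2) * (τ ^ 2 + y ^ 2)⁻¹ := by
    have h1 := (integrable_inv_one_add_sq.comp_div hτ.ne').const_mul (Real.Gamma (τ + 2) * (τ ^ 2)⁻¹)
    refine h1.congr (.of_forall fun y => ?_)
    have : τ ^ 2 + y ^ 2 ≠ 0 := by positivity
    have : 1 + (y / τ) ^ 2 ≠ 0 := by positivity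
    simp only
    field_simp
  refine hint.mono' (continuous_Gamma_vertical hτ).aestronglyMeasurable (.of_forall fun y => ?_)
  set s : ℂ := τ + y * Complex.I with hs
  have hre : s.re = τ := by simp [hs]
  have him : s.im = y := by simp [hs]
  have h0 : s ≠ 0 := fun h => by rw [h] at hre; simp at hre; linarith
  have h1 : s + 1 ≠ 0 := fun h => by
    have := congrArg Complex.re h
    simp [hre] at this; linarith
  have hG : Complex.Gamma (s + 1 + 1) = (s + 1) * (s * Complex.Gamma s) := by
    rw [Complex.Gamma_add_one _ h1, Complex.Gamma_add_one _ h0]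
  have hle : ‖Complex.Gamma (s + 1 + 1)‖ ≤ Real.Gamma (τ + 2) := by
    have h2 : (s + 1 + 1).re = τ + 2 := by simp [hre]; ring
    have := norm_Gamma_le_Gamma_re (s := s + 1 + 1) (by rw [h2]; linarith)
    rwa [h2] at this
  rw [hG, norm_mul, norm_mul] at hle
  have hn : ‖s‖ * ‖s‖ = τ ^ 2 + y ^ 2 := by
    rw [Complex.norm_mul_self_eq_normSq, Complex.normSq_apply, hre, him]; ring
  have hn1 : ‖s‖ ≤ ‖s + 1‖ := by
    rw [← sq_le_sq₀ (norm_nonneg _) (norm_nonneg _), Complex.sq_norm, Complex.sq_norm,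
      Complex.normSq_apply, Complex.normSq_apply]
    simp [hre, him]; nlinarith
  rw [← div_eq_mul_inv, le_div_iff₀ (by positivity), ← hn]
  calc ‖Complex.Gamma s‖ * (‖s‖ * ‖s‖) ≤ ‖Complex.Gamma s‖ * (‖s + 1‖ * ‖s‖) := by gcongr
    _ = ‖s + 1‖ * (‖s‖ * ‖Complex.Gamma s‖) := by ring
    _ ≤ _ := hle

theorem exp_neg_eq_integral_Gamma {τ x : ℝ} (hτ : 0 < τ) (hx : 0 < x) :
    (Real.exp (-x) : ℂ) = 1 / (2 * Real.pi) *
      ∫ y : ℝ, Complex.Gamma (τ + y * Complex.I) * (x : ℂ) ^ (-(τ + y * Complex.I) : ℂ) := by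
  have hmel : ∀ s : ℂ, 0 < s.re → mellin (fun x : ℝ => (Real.exp (-x) : ℂ)) s = Complex.Gamma s := by
    intro s hs
    rw [Complex.Gamma_eq_integral hs, Complex.GammaIntegral_eq_mellin]
  have hv : Complex.VerticalIntegrable (mellin (fun x : ℝ => (Real.exp (-x) : ℂ))) τ := by
    refine (verticalIntegrable_Gamma hτ).congr (.of_forall fun y => ?_)
    exact (hmel _ (by simpa using hτ)).symm
  have hc : MellinConvergent (fun x : ℝ => (Real.exp (-x) : ℂ)) τ := by
    have := Complex.GammaIntegral_convergent (s := τ) (by simpa using hτ)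
    refine this.congr (.of_forall fun x => ?_)
    simp [mul_comm]
  have := mellinInv_mellin_eq τ (fun x : ℝ => (Real.exp (-x) : ℂ)) hx hc hv
    (Continuous.continuousAt (by fun_prop))
  rw [← this, mellinInv, Complex.real_smul, Complex.ofReal_div, Complex.ofReal_one,
    Complex.ofReal_mul, Complex.ofReal_ofNat]
  congr 2
  ext y
  rw [hmel _ (by simpa using hτ), smul_eq_mul, mul_comm]

/-! ### The Beta integral in hyperbolic form. -/

theorem hasDerivAt_logistic (t : ℝ) :
    HasDerivAt (fun t => Real.exp t / (2 * Real.cosh t))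
      (2 * (Real.exp t / (2 * Real.cosh t)) * (Real.exp (-t) / (2 * Real.cosh t))) t := by
  have hc := Real.cosh_pos t
  have h := (Real.hasDerivAt_exp t).div ((Real.hasDerivAt_cosh t).const_mul 2) (by positivity)
  refine h.congr_deriv ?_
  have : Real.exp (-t) = Real.cosh t - Real.sinh t := (Real.cosh_sub_sinh t).symm
  rw [this]
  field_simp

theorem one_sub_logistic (t : ℝ) :
    1 - Real.exp t / (2 * Real.cosh t) = Real.exp (-t) / (2 * Real.cosh t) := by
  have hc := Real.cosh_pos t
  rw [← Real.cosh_sub_sinh t, ← Real.cosh_add_sinh t]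
  field_simp
  ring

theorem strictMono_logistic : StrictMono fun t => Real.exp t / (2 * Real.cosh t) := by
  refine strictMono_of_deriv_pos fun t => ?_
  rw [(hasDerivAt_logistic t).deriv]
  have hc := Real.cosh_pos t
  positivity

theorem image_logistic :
    (fun t => Real.exp t / (2 * Real.cosh t)) '' Set.univ = Set.Ioo 0 1 := by
  ext u
  simp only [Set.image_univ, Set.mem_range, Set.mem_Ioo]
  constructor
  · rintro ⟨t, rfl⟩
    have hc := Real.cosh_pos t
    refine ⟨by positivity, ?_⟩
    have := one_sub_logistic t
    have h2 : 0 < Real.exp (-t) / (2 * Real.cosh t) := by positivity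
    linarith
  · rintro ⟨h0, h1⟩
    have h1' : 0 < 1 - u := by linarith
    refine ⟨Real.log (u / (1 - u)) / 2, ?_⟩
    set t := Real.log (u / (1 - u)) / 2 with ht
    have hu : Real.exp t * Real.exp t = u / (1 - u) := by
      rw [← Real.exp_add, ht, add_halves, Real.exp_log (by positivity)]
    have he := Real.exp_pos t
    rw [Real.cosh_eq, Real.exp_neg]
    field_simp
    rw [eq_div_iff h1'.ne'] at hu
    linear_combination hu

/-- With `u = e^t / (2 cosh t)` the Jacobian is `2u(1-u)`, which raises the Beta exponents `a-1`,
`b-1` to `a`, `b`; then `u^a (1-u)^b` collapses because `1-u = e^{-t} / (2 cosh t)`. -/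
theorem logistic_substitution (a b : ℂ) (t : ℝ) :
    |2 * (Real.exp t / (2 * Real.cosh t)) * (Real.exp (-t) / (2 * Real.cosh t))| •
      (((Real.exp t / (2 * Real.cosh t) : ℝ) : ℂ) ^ (a - 1) *
        (1 - ((Real.exp t / (2 * Real.cosh t) : ℝ) : ℂ)) ^ (b - 1)) =
      2 * (Complex.exp ((a - b) * t) * ((2 * Real.cosh t : ℝ) : ℂ) ^ (-(a + b))) := by
  have hc := Real.cosh_pos t
  have hlog (e : ℝ) (z : ℂ) : ((Real.exp e / (2 * Real.cosh t) : ℝ) : ℂ) ^ z =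
      Complex.exp ((e - Real.log (2 * Real.cosh t)) * z) := by
    rw [Complex.cpow_def_of_ne_zero (by exact_mod_cast (by positivity)), ← Complex.ofReal_log
      (by positivity), Real.log_div (by positivity) (by positivity), Real.log_exp]
    push_cast; rfl
  have h1 : (1 : ℂ) - ((Real.exp t / (2 * Real.cosh t) : ℝ) : ℂ) =
      ((Real.exp (-t) / (2 * Real.cosh t) : ℝ) : ℂ) := by
    rw [← one_sub_logistic]; push_cast; rfl
  have h2 (e : ℝ) : ((Real.exp e / (2 * Real.cosh t) : ℝ) : ℂ) =
      Complex.exp ((e - Real.log (2 * Real.cosh t))) := by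
    rw [← Complex.cpow_one ((Real.exp e / (2 * Real.cosh t) : ℝ) : ℂ), hlog, mul_one]
  rw [abs_of_pos (by positivity), h1, hlog, hlog, Complex.real_smul, Complex.ofReal_mul,
    Complex.ofReal_mul, h2, h2, Complex.cpow_def_of_ne_zero (by exact_mod_cast (by positivity)),
    ← Complex.ofReal_log (by positivity), ← Complex.exp_add]
  rw [Complex.ofReal_ofNat, mul_assoc, mul_assoc, ← Complex.exp_add, ← Complex.exp_add, ← Complex.exp_add]
  congr 2
  push_cast
  ring

theorem integrable_exp_mul_cosh_cpow {a b : ℂ} (ha : 0 < a.re) (hb : 0 < b.re) :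
    Integrable fun t : ℝ => Complex.exp ((a - b) * t) * ((2 * Real.cosh t : ℝ) : ℂ) ^ (-(a + b)) := by
  have h := (integrableOn_image_iff_integrableOn_abs_deriv_smul MeasurableSet.univ
    (fun t _ => (hasDerivAt_logistic t).hasDerivWithinAt) strictMono_logistic.injective.injOn
    (fun u : ℝ => (u : ℂ) ^ (a - 1) * (1 - (u : ℂ)) ^ (b - 1))).1 (by
      rw [image_logistic]
      exact ((intervalIntegrable_iff_integrableOn_Ioo_of_le zero_le_one).1
        (Complex.betaIntegral_convergent ha hb)))
  rw [integrableOn_univ] at h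
  simp_rw [logistic_substitution] at h
  exact (integrable_const_mul_iff (by simp) _).1 h

theorem integral_exp_mul_cosh_cpow (a b : ℂ) :
    ∫ t : ℝ, Complex.exp ((a - b) * t) * ((2 * Real.cosh t : ℝ) : ℂ) ^ (-(a + b)) =
      Complex.betaIntegral a b / 2 := by
  have h := (integral_image_eq_integral_abs_deriv_smul MeasurableSet.univ
    (fun t _ => (hasDerivAt_logistic t).hasDerivWithinAt) strictMono_logistic.injective.injOn
    (fun u : ℝ => (u : ℂ) ^ (a - 1) * (1 - (u : ℂ)) ^ (b - 1)))
  rw [image_logistic, setIntegral_univ] at h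
  simp_rw [logistic_substitution] at h
  rw [integral_const_mul, ← integral_Ioc_eq_integral_Ioo,
    ← intervalIntegral.integral_of_le zero_le_one] at h
  rw [Complex.betaIntegral, h]
  ring

theorem integrable_cosh_mul_cosh_cpow {a b : ℂ} (ha : 0 < a.re) (hb : 0 < b.re) :
    Integrable fun t : ℝ => Complex.cosh ((a - b) * t) * ((2 * Real.cosh t : ℝ) : ℂ) ^ (-(a + b)) := by
  have h := ((integrable_exp_mul_cosh_cpow ha hb).add (integrable_exp_mul_cosh_cpow hb ha)).div_const 2
  refine h.congr (.of_forall fun t => ?_)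
  simp only [Pi.add_apply, Complex.cosh]
  rw [add_comm b a, show (b - a) * (t : ℂ) = -((a - b) * t) by ring]
  ring

/-- The integrand is even and is the average of the exponential forms for `(a, b)` and `(b, a)`,
which have equal integrals by symmetry of the Beta function. -/
theorem integral_Ioi_cosh_mul_cosh_cpow {a b : ℂ} (ha : 0 < a.re) (hb : 0 < b.re) :
    ∫ t in Set.Ioi (0 : ℝ), Complex.cosh ((a - b) * t) *
      ((2 * Real.cosh t : ℝ) : ℂ) ^ (-(a + b)) = Complex.betaIntegral a b / 4 := by
  set g : ℝ → ℂ := fun t => Complex.cosh ((a - b) * t) * ((2 * Real.cosh t : ℝ) : ℂ) ^ (-(a + b))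
    with hg
  have hgi := integrable_cosh_mul_cosh_cpow ha hb
  have heven : ∀ t, g (-t) = g t := by
    intro t
    simp [hg, Complex.cosh_neg]
  have hsplit : ∫ t, g t = 2 * ∫ t in Set.Ioi (0 : ℝ), g t := by
    rw [← intervalIntegral.integral_Iic_add_Ioi (b := 0) hgi.integrableOn hgi.integrableOn]
    have : ∫ t in Set.Iic (0 : ℝ), g t = ∫ t in Set.Ioi (0 : ℝ), g t := by
      have := integral_comp_neg_Ioi (0 : ℝ) g
      simp only [heven, neg_zero] at this
      exact this.symm
    rw [this]; ring
  have hfull : ∫ t, g t = Complex.betaIntegral a b / 2 := by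
    have h : ∀ t : ℝ, g t = (Complex.exp ((a - b) * t) * ((2 * Real.cosh t : ℝ) : ℂ) ^ (-(a + b)) +
        Complex.exp ((b - a) * t) * ((2 * Real.cosh t : ℝ) : ℂ) ^ (-(b + a))) / 2 := by
      intro t
      simp only [hg, Complex.cosh]
      rw [add_comm b a, show (b - a) * (t : ℂ) = -((a - b) * t) by ring]
      ring
    simp_rw [h]
    rw [integral_div, integral_add (integrable_exp_mul_cosh_cpow ha hb)
      (integrable_exp_mul_cosh_cpow hb ha), integral_exp_mul_cosh_cpow,
      integral_exp_mul_cosh_cpow, Complex.betaIntegral_symm]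
    ring
  rw [hfull] at hsplit
  linear_combination -hsplit / 2

/-! ### Mellin transform of the Bessel function and moments of the generalized-K law. -/

theorem besselK_nonneg (ν x : ℝ) : 0 ≤ besselK ν x :=
  integral_nonneg fun t => by positivity

theorem measurable_besselK (ν : ℝ) : Measurable (besselK ν) := by
  have h : StronglyMeasurable (Function.uncurry fun x t : ℝ =>
      Real.exp (-x * Real.cosh t) * Real.cosh (ν * t)) := by
    refine Continuous.stronglyMeasurable ?_
    unfold Function.uncurry
    fun_prop
  exact h.integral_prod_right.measurable

theorem generalizedKPDF_nonneg {m k P : ℝ} (hm : 0 < m) (hk : 0 < k) (hP : 0 < P) (r : ℝ) :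
    0 ≤ generalizedKPDF m k P r := by
  unfold generalizedKPDF
  split_ifs with h
  · have := besselK_nonneg (k - m) (2 * Real.sqrt (k * m / P) * r)
    have := Real.Gamma_pos_of_pos hm
    have := Real.Gamma_pos_of_pos hk
    positivity
  · exact le_rfl

theorem measurable_generalizedKPDF (m k P : ℝ) : Measurable (generalizedKPDF m k P) := by
  unfold generalizedKPDF
  refine Measurable.ite measurableSet_Ioi ?_ measurable_const
  exact (by fun_prop : Measurable fun r : ℝ => 4 * (k * m / P) ^ ((k + m) / 2) /
    (Real.Gamma m * Real.Gamma k) * r ^ (k + m - 1)).mul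
    ((measurable_besselK _).comp (by fun_prop))

theorem ae_pos_generalizedKMeasure (m k P : ℝ) : ∀ᵐ r ∂generalizedKMeasure m k P, 0 < r := by
  rw [generalizedKMeasure, ae_withDensity_iff (measurable_generalizedKPDF m k P).ennreal_ofReal]
  refine .of_forall fun r hr => ?_
  by_contra h
  simp [generalizedKPDF, h] at hr

/-- Justifies Fubini: integrating the norm over `r` is a Gamma integral, and what remains is a
constant times the norm of the hyperbolic Beta integrand. -/
theorem integrable_besselK_kernel {a b : ℂ} (ha : 0 < a.re) (hb : 0 < b.re) {q : ℝ} (hq : 0 < q) :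
    Integrable (Function.uncurry fun r t : ℝ => (r : ℂ) ^ (a + b - 1) *
        Complex.exp (-((2 * q * Real.cosh t : ℝ) * r)) * Complex.cosh ((a - b) * t))
      ((volume.restrict (Set.Ioi 0)).prod (volume.restrict (Set.Ioi 0))) := by
  have hab : 0 < (a + b).re := by simp; linarith
  have hcosh (t : ℝ) : 0 < 2 * q * Real.cosh t := by
    have := Real.cosh_pos t
    positivity
  have hmeas : Measurable (Function.uncurry fun r t : ℝ => (r : ℂ) ^ (a + b - 1) *
        Complex.exp (-((2 * q * Real.cosh t : ℝ) * r)) * Complex.cosh ((a - b) * t)) := by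
    unfold Function.uncurry
    refine ((((Complex.measurable_ofReal.comp measurable_fst).pow_const _).mul ?_)).mul ?_
    · exact Continuous.measurable (by fun_prop)
    · exact Continuous.measurable (by fun_prop)
  have hnorm (t : ℝ) : Set.EqOn (fun r : ℝ => ‖(r : ℂ) ^ (a + b - 1) *
        Complex.exp (-((2 * q * Real.cosh t : ℝ) * r)) * Complex.cosh ((a - b) * t)‖)
      (fun r => r ^ ((a + b).re - 1) * Real.exp (-((2 * q * Real.cosh t) * r)) *
        ‖Complex.cosh ((a - b) * t)‖) (Set.Ioi 0) := by
    intro r hr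
    simp only [norm_mul]
    rw [Complex.norm_cpow_eq_rpow_re_of_pos hr, Complex.norm_exp]
    congr 2
    rw [← Complex.ofReal_mul, ← Complex.ofReal_neg, Complex.ofReal_re]
  refine (integrable_prod_iff' hmeas.aestronglyMeasurable).2 ⟨.of_forall fun t => ?_, ?_⟩
  · refine (integrable_norm_iff ?_).1 ?_
    · exact (hmeas.comp (measurable_id.prodMk measurable_const)).aestronglyMeasurable
    · refine IntegrableOn.congr_fun ?_ (hnorm t).symm measurableSet_Ioi
      have := Real.integral_rpow_mul_exp_neg_mul_Ioi hab (hcosh t)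
      -- A non-integrable function has Bochner integral `0`, whereas the Gamma formula gives a
      -- positive value.
      refine Integrable.mul_const (by_contra fun hn => ?_) _
      rw [integral_undef hn] at this
      have h1 := Real.Gamma_pos_of_pos hab
      have h2 := hcosh t
      have : 0 < (1 / (2 * q * Real.cosh t)) ^ (a + b).re * Real.Gamma (a + b).re := by positivity
      linarith
  · have h := ((integrable_cosh_mul_cosh_cpow ha hb).norm.const_mul
      (Real.Gamma (a + b).re * (1 / q) ^ (a + b).re)).integrableOn (s := Set.Ioi 0)
    refine h.congr (.of_forall fun t => ?_)
    have hc := Real.cosh_pos t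
    simp only [Function.uncurry]
    rw [setIntegral_congr_fun measurableSet_Ioi (hnorm t), integral_mul_const,
      Real.integral_rpow_mul_exp_neg_mul_Ioi hab (hcosh t), norm_mul,
      Complex.norm_cpow_eq_rpow_re_of_pos (by positivity), Complex.neg_re,
      Real.rpow_neg (by positivity), ← Real.inv_rpow (by positivity),
      show 1 / (2 * q * Real.cosh t) = (1 / q) * (2 * Real.cosh t)⁻¹ by field_simp,
      Real.mul_rpow (by positivity) (by positivity)]
    ring

theorem ofReal_besselK {a b : ℂ} {ν : ℝ} (hν : a - b = ν) (q r : ℝ) :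
    (r : ℂ) ^ (a + b - 1) * (besselK ν (2 * q * r) : ℂ) =
      ∫ t in Set.Ioi (0 : ℝ), (r : ℂ) ^ (a + b - 1) *
        Complex.exp (-((2 * q * Real.cosh t : ℝ) * r)) * Complex.cosh ((a - b) * t) := by
  rw [besselK, ← integral_complex_ofReal, ← integral_const_mul]
  congr 1
  ext t
  rw [hν, mul_assoc, show -(((2 * q * Real.cosh t : ℝ) : ℂ) * r) =
    ((-(2 * q * r) * Real.cosh t : ℝ) : ℂ) by push_cast; ring]
  push_cast
  simp only [mul_assoc]

theorem integrable_cpow_mul_besselK {a b : ℂ} (ha : 0 < a.re) (hb : 0 < b.re) {ν : ℝ}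
    (hν : a - b = ν) {q : ℝ} (hq : 0 < q) :
    IntegrableOn (fun r : ℝ => (r : ℂ) ^ (a + b - 1) * (besselK ν (2 * q * r) : ℂ))
      (Set.Ioi 0) := by
  simp_rw [ofReal_besselK hν]
  exact (integrable_besselK_kernel ha hb hq).integral_prod_left

/-- After the swap, the `r`-integral yields `Γ(a+b) (2q cosh t)^{-(a+b)}` and the `t`-integral a
Beta value; `Γ(a+b) B(a,b) = Γ(a) Γ(b)` finishes. -/
theorem integral_cpow_mul_besselK {a b : ℂ} (ha : 0 < a.re) (hb : 0 < b.re) {ν : ℝ}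
    (hν : a - b = ν) {q : ℝ} (hq : 0 < q) :
    ∫ r in Set.Ioi (0 : ℝ), (r : ℂ) ^ (a + b - 1) * (besselK ν (2 * q * r) : ℂ) =
      (q : ℂ) ^ (-(a + b)) * (Complex.Gamma a * Complex.Gamma b) / 4 := by
  have hab : 0 < (a + b).re := by simp; linarith
  simp_rw [ofReal_besselK hν]
  rw [integral_integral_swap (integrable_besselK_kernel ha hb hq)]
  have hinner (t : ℝ) : ∫ r in Set.Ioi (0 : ℝ), (r : ℂ) ^ (a + b - 1) *
        Complex.exp (-((2 * q * Real.cosh t : ℝ) * r)) * Complex.cosh ((a - b) * t) =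
      (q : ℂ) ^ (-(a + b)) * Complex.Gamma (a + b) * (Complex.cosh ((a - b) * t) *
        ((2 * Real.cosh t : ℝ) : ℂ) ^ (-(a + b))) := by
    have hc := Real.cosh_pos t
    rw [integral_mul_const, Complex.integral_cpow_mul_exp_neg_mul_Ioi hab (by positivity),
      one_div, ← Complex.ofReal_inv, show 2 * q * Real.cosh t = q * (2 * Real.cosh t) by ring,
      mul_inv, Complex.ofReal_mul, Complex.mul_cpow_ofReal_nonneg (by positivity) (by positivity),
      Complex.ofReal_inv, Complex.ofReal_inv, Complex.inv_cpow, Complex.inv_cpow,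
      Complex.cpow_neg, Complex.cpow_neg]
    · ring
    · rw [Complex.arg_ofReal_of_nonneg (by positivity)]; exact Real.pi_ne_zero.symm
    · rw [Complex.arg_ofReal_of_nonneg hq.le]; exact Real.pi_ne_zero.symm
  simp_rw [hinner]
  rw [integral_const_mul, integral_Ioi_cosh_mul_cosh_cpow ha hb,
    Complex.Gamma_mul_Gamma_eq_betaIntegral ha hb]
  ring

/-- Puts the moment integrand in Bessel–Mellin form with `a = k + z`, `b = m + z`: the shift by `z`
leaves the order `a - b = k - m` real. -/
theorem generalizedKPDF_smul_cpow {m k P : ℝ} (hm : 0 < m) (hk : 0 < k) (hP : 0 < P) (z : ℂ) (r : ℝ) :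
    (ENNReal.ofReal (generalizedKPDF m k P r)).toReal • ((r ^ 2 : ℝ) : ℂ) ^ z =
      (Set.Ioi (0 : ℝ)).indicator (fun r : ℝ =>
        (4 * (Real.sqrt (k * m / P) : ℂ) ^ ((k + m : ℝ) : ℂ) /
          (Complex.Gamma m * Complex.Gamma k)) *
        ((r : ℂ) ^ ((k + z) + (m + z) - 1) *
          (besselK (k - m) (2 * Real.sqrt (k * m / P) * r) : ℂ))) r := by
  rw [ENNReal.toReal_ofReal (generalizedKPDF_nonneg hm hk hP r), Complex.real_smul]
  by_cases hr : 0 < r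
  · rw [Set.indicator_of_mem (by exact hr), generalizedKPDF, if_pos hr]
    have hβ : 0 < k * m / P := by positivity
    have h1 : (k * m / P) ^ ((k + m) / 2) = (Real.sqrt (k * m / P)) ^ (k + m) := by
      rw [Real.sqrt_eq_rpow, ← Real.rpow_mul hβ.le]; ring_nf
    have h2 : ((r ^ 2 : ℝ) : ℂ) ^ z = (r : ℂ) ^ (2 * z) := by
      rw [sq, Complex.ofReal_mul, Complex.mul_cpow_ofReal_nonneg hr.le hr.le,
        ← Complex.cpow_add _ _ (by exact_mod_cast hr.ne'), two_mul]
    have h3 : ((r ^ (k + m - 1) : ℝ) : ℂ) * (r : ℂ) ^ (2 * z) =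
        (r : ℂ) ^ ((k + z) + (m + z) - 1) := by
      rw [Complex.ofReal_cpow hr.le, ← Complex.cpow_add _ _ (by exact_mod_cast hr.ne')]
      congr 1; push_cast; ring
    rw [h1, h2, ← h3, Complex.Gamma_ofReal, Complex.Gamma_ofReal,
      ← Complex.ofReal_cpow (Real.sqrt_nonneg _)]
    push_cast
    ring
  · rw [Set.indicator_of_notMem (by exact hr), generalizedKPDF, if_neg hr]
    simp

theorem integrable_cpow_generalizedK {m k P : ℝ} (hm : 0 < m) (hk : 0 < k) (hP : 0 < P) {z : ℂ}
    (hzm : 0 < m + z.re) (hzk : 0 < k + z.re) :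
    Integrable (fun r : ℝ => ((r ^ 2 : ℝ) : ℂ) ^ z) (generalizedKMeasure m k P) := by
  rw [generalizedKMeasure, integrable_withDensity_iff_integrable_smul'
    (measurable_generalizedKPDF m k P).ennreal_ofReal (.of_forall fun _ => ENNReal.ofReal_lt_top)]
  simp_rw [generalizedKPDF_smul_cpow hm hk hP]
  refine (integrable_indicator_iff measurableSet_Ioi).2 ?_
  exact Integrable.const_mul (integrable_cpow_mul_besselK (a := k + z) (b := m + z)
    (by simpa using hzk) (by simpa using hzm) (by push_cast; ring)
    (Real.sqrt_pos.2 (by positivity))) _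

theorem integral_cpow_generalizedK {m k P : ℝ} (hm : 0 < m) (hk : 0 < k) (hP : 0 < P) {z : ℂ}
    (hzm : 0 < m + z.re) (hzk : 0 < k + z.re) :
    ∫ r : ℝ, ((r ^ 2 : ℝ) : ℂ) ^ z ∂generalizedKMeasure m k P =
      ((k * m / P : ℝ) : ℂ) ^ (-z) * (Complex.Gamma (m + z) * Complex.Gamma (k + z)) /
        (Complex.Gamma m * Complex.Gamma k) := by
  rw [generalizedKMeasure, integral_withDensity_eq_integral_toReal_smul
    (measurable_generalizedKPDF m k P).ennreal_ofReal (.of_forall fun _ => ENNReal.ofReal_lt_top)]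
  simp_rw [generalizedKPDF_smul_cpow hm hk hP]
  have hβ : 0 < k * m / P := by positivity
  have hq : 0 < Real.sqrt (k * m / P) := Real.sqrt_pos.2 hβ
  rw [integral_indicator measurableSet_Ioi, integral_const_mul,
    integral_cpow_mul_besselK (a := k + z) (b := m + z)
    (by simpa using hzk) (by simpa using hzm) (by push_cast; ring) hq]
  have h : (Real.sqrt (k * m / P) : ℂ) ^ ((k + m : ℝ) : ℂ) *
      (Real.sqrt (k * m / P) : ℂ) ^ (-((k + z) + (m + z))) = ((k * m / P : ℝ) : ℂ) ^ (-z) := by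
    conv_rhs => rw [← Real.mul_self_sqrt hβ.le, Complex.ofReal_mul,
      Complex.mul_cpow_ofReal_nonneg hq.le hq.le]
    rw [← Complex.cpow_add _ _ (by exact_mod_cast hq.ne'),
      ← Complex.cpow_add _ _ (by exact_mod_cast hq.ne')]
    congr 1; push_cast; ring
  rw [← h]
  ring

/-! ### Laplace transforms of positive laws: derivative and Mellin–Barnes form. -/

theorem hasDerivAt_integral_exp_neg {ν : Measure ℝ} [IsFiniteMeasure ν] (hν : ∀ᵐ v ∂ν, 0 < v)
    {s : ℝ} (hs : 0 < s) :
    HasDerivAt (fun u : ℝ => ∫ v, Real.exp (-u * v) ∂ν) (-∫ v, v * Real.exp (-s * v) ∂ν) s := by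
  have hmeas (u : ℝ) : AEStronglyMeasurable (fun v : ℝ => Real.exp (-u * v)) ν :=
    (by fun_prop : Continuous fun v : ℝ => Real.exp (-u * v)).aestronglyMeasurable
  rw [← integral_neg]
  -- For `u > s/2`, the inequality `uv ≤ e^{uv}` gives `v e^{-uv} ≤ 1/u < 2/s`. The bound is
  -- constant, so no first moment of `v` is needed.
  refine (hasDerivAt_integral_of_dominated_loc_of_deriv_le (bound := fun _ => 2 / s)
    (F' := fun u v => -(v * Real.exp (-u * v))) (Ioi_mem_nhds (half_lt_self hs))
    (.of_forall hmeas) ?_ ?_ ?_ (integrable_const _) ?_).2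
  · refine (integrable_const (1 : ℝ)).mono' (hmeas s) ?_
    filter_upwards [hν] with v hv
    rw [Real.norm_eq_abs, abs_of_pos (Real.exp_pos _), Real.exp_le_one_iff]
    nlinarith
  · exact (by fun_prop : Continuous fun v : ℝ => -(v * Real.exp (-s * v))).aestronglyMeasurable
  · filter_upwards [hν] with v hv u hu
    have hu' : s / 2 < u := hu
    have hu0 : 0 < u := by linarith
    rw [norm_neg, Real.norm_eq_abs, abs_of_pos (by positivity), neg_mul, Real.exp_neg,
      ← div_eq_mul_inv, div_le_div_iff₀ (Real.exp_pos _) hs]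
    nlinarith [Real.add_one_le_exp (u * v), mul_pos (sub_pos.2 hu') hv]
  · refine .of_forall fun v u _ => ?_
    have h := ((hasDerivAt_id u).neg.mul_const v).exp
    refine h.congr_deriv ?_
    simp
    ring

/-- Fubini needs only one real moment: on the line, `|v^{1-u}| = v^{1-τ}` does not depend on `y`, so
the norm of the kernel splits into a function of `v` times a function of `y`. -/
theorem integral_mul_exp_neg_eq {ν : Measure ℝ} [IsFiniteMeasure ν] (hν : ∀ᵐ v ∂ν, 0 < v)
    {s τ : ℝ} (hs : 0 < s) (hτ : 0 < τ)
    (hint : Integrable (fun v : ℝ => (v : ℂ) ^ ((1 - τ : ℝ) : ℂ)) ν) :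
    ((∫ v, v * Real.exp (-s * v) ∂ν : ℝ) : ℂ) = 1 / (2 * Real.pi) *
      ∫ y : ℝ, Complex.Gamma (τ + y * Complex.I) * (s : ℂ) ^ (-(τ + y * Complex.I) : ℂ) *
        ∫ v, (v : ℂ) ^ (1 - (τ + y * Complex.I) : ℂ) ∂ν := by
  have hpt : ∀ᵐ v ∂ν, ((v * Real.exp (-s * v) : ℝ) : ℂ) = 1 / (2 * Real.pi) *
      ∫ y : ℝ, Complex.Gamma (τ + y * Complex.I) * (s : ℂ) ^ (-(τ + y * Complex.I) : ℂ) *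
        (v : ℂ) ^ (1 - (τ + y * Complex.I) : ℂ) := by
    filter_upwards [hν] with v hv
    have hv0 : (v : ℂ) ≠ 0 := by exact_mod_cast hv.ne'
    rw [neg_mul, Complex.ofReal_mul, exp_neg_eq_integral_Gamma hτ (mul_pos hs hv), mul_left_comm,
      ← integral_const_mul]
    congr 2
    ext y
    rw [Complex.ofReal_mul, Complex.mul_cpow_ofReal_nonneg hs.le hv.le, sub_eq_add_neg,
      Complex.cpow_add _ _ hv0, Complex.cpow_one]
    ring
  have hmeas : Measurable (Function.uncurry fun v y : ℝ =>
      Complex.Gamma (τ + y * Complex.I) * (s : ℂ) ^ (-(τ + y * Complex.I) : ℂ) *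
        (v : ℂ) ^ (1 - (τ + y * Complex.I) : ℂ)) := by
    unfold Function.uncurry
    have h1 := (continuous_Gamma_vertical hτ).measurable.comp (measurable_snd : Measurable (Prod.snd : ℝ × ℝ → ℝ))
    exact (h1.mul (by fun_prop)).mul (by fun_prop)
  have hF : Integrable (Function.uncurry fun v y : ℝ =>
      Complex.Gamma (τ + y * Complex.I) * (s : ℂ) ^ (-(τ + y * Complex.I) : ℂ) *
        (v : ℂ) ^ (1 - (τ + y * Complex.I) : ℂ)) (ν.prod volume) := by
    have hprod := hint.norm.mul_prod ((verticalIntegrable_Gamma hτ).norm.mul_const (s ^ (-τ)))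
    refine hprod.mono' hmeas.aestronglyMeasurable ?_
    have hfst : ∀ᵐ x : ℝ × ℝ ∂ν.prod volume, 0 < x.1 := Measure.quasiMeasurePreserving_fst.ae hν
    filter_upwards [hfst] with x hx
    simp only [Function.uncurry, norm_mul]
    rw [Complex.norm_cpow_eq_rpow_re_of_pos hs, Complex.norm_cpow_eq_rpow_re_of_pos hx,
      Complex.norm_cpow_eq_rpow_re_of_pos hx]
    simp
    exact le_of_eq (by ring)
  rw [← integral_complex_ofReal, integral_congr_ae hpt, integral_const_mul,
    integral_integral_swap hF]
  congr 2
  ext y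
  rw [integral_const_mul]

/-! ### Complex moments of the signal-to-noise ratio. -/

theorem ofReal_ratio_cpow {w N₀ : ℝ} (hw : 0 < w) (hN₀ : 0 < N₀) (r t : ℝ) (p : ℂ) :
    ((w * r ^ 2 / (N₀ * t ^ 2) : ℝ) : ℂ) ^ p =
      ((w / N₀ : ℝ) : ℂ) ^ p * (((r ^ 2 : ℝ) : ℂ) ^ p * ((t ^ 2 : ℝ) : ℂ) ^ (-p)) := by
  rw [show w * r ^ 2 / (N₀ * t ^ 2) = w / N₀ * (r ^ 2 * (t ^ 2)⁻¹) by
      rw [mul_div_mul_comm, div_eq_mul_inv (r ^ 2)],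
    Complex.ofReal_mul, Complex.mul_cpow_ofReal_nonneg (by positivity) (by positivity),
    Complex.ofReal_mul, Complex.mul_cpow_ofReal_nonneg (by positivity) (by positivity),
    Complex.ofReal_inv, Complex.inv_cpow, Complex.cpow_neg]
  rw [Complex.arg_ofReal_of_nonneg (by positivity)]
  exact Real.pi_ne_zero.symm

section Ratio

variable {S : Type*} [MeasurableSpace S] {μ : Measure S}
  {R T : S → ℝ} {m k P m' k' P' w N₀ : ℝ}

theorem HasLaw.ae_pos_generalizedK (hR : HasLaw R (generalizedKMeasure m k P) μ) :
    ∀ᵐ x ∂μ, 0 < R x := by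
  have h := ae_pos_generalizedKMeasure m k P
  rw [← hR.map_eq] at h
  exact ae_of_ae_map hR.aemeasurable h

theorem HasLaw.integrable_sq_cpow (hm : 0 < m) (hk : 0 < k) (hP : 0 < P)
    (hR : HasLaw R (generalizedKMeasure m k P) μ) {z : ℂ}
    (hzm : 0 < m + z.re) (hzk : 0 < k + z.re) :
    Integrable (fun x => ((R x ^ 2 : ℝ) : ℂ) ^ z) μ := by
  have h := integrable_cpow_generalizedK hm hk hP hzm hzk
  rw [← hR.map_eq] at h
  exact h.comp_aemeasurable hR.aemeasurable

theorem HasLaw.integral_sq_cpow (hm : 0 < m) (hk : 0 < k) (hP : 0 < P)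
    (hR : HasLaw R (generalizedKMeasure m k P) μ) {z : ℂ}
    (hzm : 0 < m + z.re) (hzk : 0 < k + z.re) :
    ∫ x, ((R x ^ 2 : ℝ) : ℂ) ^ z ∂μ =
      ((k * m / P : ℝ) : ℂ) ^ (-z) * (Complex.Gamma (m + z) * Complex.Gamma (k + z)) /
        (Complex.Gamma m * Complex.Gamma k) := by
  rw [← integral_cpow_generalizedK hm hk hP hzm hzk, ← hR.integral_comp
    (integrable_cpow_generalizedK hm hk hP hzm hzk).aestronglyMeasurable]
  rfl

theorem indepFun_sq_cpow (hind : IndepFun (fun x => R x ^ 2) (fun x => T x ^ 2) μ) (p q : ℂ) :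
    IndepFun (fun x => ((R x ^ 2 : ℝ) : ℂ) ^ p) (fun x => ((T x ^ 2 : ℝ) : ℂ) ^ q) μ :=
  hind.comp (φ := fun u : ℝ => (u : ℂ) ^ p) (ψ := fun u : ℝ => (u : ℂ) ^ q)
    (by fun_prop) (by fun_prop)

theorem integrable_ratio_cpow (hm : 0 < m) (hk : 0 < k) (hP : 0 < P) (hm' : 0 < m') (hk' : 0 < k')
    (hP' : 0 < P') (hw : 0 < w) (hN₀ : 0 < N₀)
    (hR : HasLaw R (generalizedKMeasure m k P) μ) (hT : HasLaw T (generalizedKMeasure m' k' P') μ)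
    (hind : IndepFun (fun x => R x ^ 2) (fun x => T x ^ 2) μ) {p : ℂ}
    (hpm : 0 < m + p.re) (hpk : 0 < k + p.re) (hpm' : 0 < m' - p.re) (hpk' : 0 < k' - p.re) :
    Integrable (fun x => ((w * R x ^ 2 / (N₀ * T x ^ 2) : ℝ) : ℂ) ^ p) μ := by
  simp_rw [ofReal_ratio_cpow hw hN₀]
  refine Integrable.const_mul ?_ _
  exact (indepFun_sq_cpow hind p (-p)).integrable_mul
    (HasLaw.integrable_sq_cpow hm hk hP hR hpm hpk)
    (HasLaw.integrable_sq_cpow hm' hk' hP' hT (by simpa [← sub_eq_add_neg] using hpm')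
      (by simpa [← sub_eq_add_neg] using hpk'))

theorem integral_ratio_cpow (hm : 0 < m) (hk : 0 < k) (hP : 0 < P) (hm' : 0 < m') (hk' : 0 < k')
    (hP' : 0 < P') (hw : 0 < w) (hN₀ : 0 < N₀)
    (hR : HasLaw R (generalizedKMeasure m k P) μ) (hT : HasLaw T (generalizedKMeasure m' k' P') μ)
    (hind : IndepFun (fun x => R x ^ 2) (fun x => T x ^ 2) μ) {p : ℂ}
    (hpm : 0 < m + p.re) (hpk : 0 < k + p.re) (hpm' : 0 < m' - p.re) (hpk' : 0 < k' - p.re) :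
    ∫ x, ((w * R x ^ 2 / (N₀ * T x ^ 2) : ℝ) : ℂ) ^ p ∂μ =
      ((k * m * P' * N₀ / (k' * m' * P * w) : ℝ) : ℂ) ^ (-p) *
        (Complex.Gamma (m + p) * Complex.Gamma (k + p) * Complex.Gamma (m' - p) *
          Complex.Gamma (k' - p)) /
        (Complex.Gamma m * Complex.Gamma m' * Complex.Gamma k * Complex.Gamma k') := by
  have hzm' : 0 < m' + (-p).re := by simpa [← sub_eq_add_neg] using hpm'
  have hzk' : 0 < k' + (-p).re := by simpa [← sub_eq_add_neg] using hpk'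
  simp_rw [ofReal_ratio_cpow hw hN₀]
  rw [integral_const_mul, (indepFun_sq_cpow hind p (-p)).integral_fun_mul_eq_mul_integral
      (HasLaw.integrable_sq_cpow hm hk hP hR hpm hpk).aestronglyMeasurable
      (HasLaw.integrable_sq_cpow hm' hk' hP' hT hzm' hzk').aestronglyMeasurable,
    HasLaw.integral_sq_cpow hm hk hP hR hpm hpk,
    HasLaw.integral_sq_cpow hm' hk' hP' hT hzm' hzk']
  -- The scale factors of the two laws and of `w / N₀` merge into the single power `C^{-p}`.
  have hC : ((k * m * P' * N₀ / (k' * m' * P * w) : ℝ) : ℂ) ^ (-p) =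
      ((w / N₀ : ℝ) : ℂ) ^ p * ((k * m / P : ℝ) : ℂ) ^ (-p) *
        ((k' * m' / P' : ℝ) : ℂ) ^ (- -p) := by
    have hinv (r : ℝ) (hr : 0 < r) (q : ℂ) : ((r⁻¹ : ℝ) : ℂ) ^ (-q) = (r : ℂ) ^ q := by
      rw [Complex.ofReal_inv, Complex.inv_cpow, Complex.cpow_neg, inv_inv]
      rw [Complex.arg_ofReal_of_nonneg hr.le]
      exact Real.pi_ne_zero.symm
    rw [show k * m * P' * N₀ / (k' * m' * P * w) =
        (w / N₀)⁻¹ * (k * m / P) * (k' * m' / P')⁻¹ by field_simp,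
      Complex.ofReal_mul, Complex.mul_cpow_ofReal_nonneg (by positivity) (by positivity),
      Complex.ofReal_mul, Complex.mul_cpow_ofReal_nonneg (by positivity) (by positivity),
      hinv _ (by positivity), hinv _ (by positivity), neg_neg]
  rw [hC, ← sub_eq_add_neg, ← sub_eq_add_neg]
  ring

end Ratio

/-! ### Identification with the Meijer function. -/

theorem separatesPoles_two_three_iff {a₁ a₂ a₃ b₁ b₂ : ℂ} {σ : ℝ} :
    SeparatesPoles 2 3 ![a₁, a₂, a₃] ![b₁, b₂] σ ↔
      (a₁.re - 1 < σ ∧ a₂.re - 1 < σ ∧ a₃.re - 1 < σ) ∧ σ < b₁.re ∧ σ < b₂.re := by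
  simp [SeparatesPoles, Fin.forall_fin_succ]

theorem meijerGIntegrand_two_three (a₁ a₂ a₃ b₁ b₂ z t : ℂ) :
    meijerGIntegrand 2 3 ![a₁, a₂, a₃] ![b₁, b₂] z t =
      Complex.Gamma (b₁ - t) * Complex.Gamma (b₂ - t) * (Complex.Gamma (1 - a₁ + t) *
        Complex.Gamma (1 - a₂ + t) * Complex.Gamma (1 - a₃ + t)) * z ^ t := by
  simp [meijerGIntegrand, Fin.prod_univ_succ, mul_assoc]

theorem lemma3 {S : Type*} [MeasurableSpace S] (μ : Measure S) [IsProbabilityMeasure μ]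
    (h : Channel → S → ℂ) (m k d α Ω : Channel → ℝ) (w N₀ : ℝ)
    (hm : ∀ c, 1 / 2 ≤ m c) (hk : ∀ c, 0 < k c) (hd : ∀ c, 0 < d c)
    (hΩ : ∀ c, Ω c = pathGain (d c) (α c)) (hw : 0 < w) (hN₀ : 0 < N₀)
    (hlaw : ∀ c, HasLaw (fun x => ‖h c x‖) (generalizedKMeasure (m c) (k c) (Ω c)) μ)
    (l : Hop) (i j : Channel) (hi : i = l.secondary) (hj : j = l.primary)
    (hindep : IndepFun (fun x => ‖h i x‖ ^ 2) (fun x => ‖h j x‖ ^ 2) μ)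
    (Δ Θ C : ℝ) (hΔ : Δ = halfSum (k i) (m i)) (hΘ : Θ = halfDiff (k i) (m i))
    (hC : C = k i * m i * Ω j * N₀ / (k j * m j * Ω i * w))
    (s : ℝ) (hs : 0 < s) :
    HasDerivAt (fun u : ℝ => ((negMGF (hopSNR h w N₀ l) μ u : ℝ) : ℂ))
      (-((C ^ Δ / (Real.Gamma (m i) * Real.Gamma (m j) * Real.Gamma (k i) * Real.Gamma (k j)
            * s ^ (Δ + 1)) : ℝ) : ℂ)
        * meijerG 2 3 ![((-Δ : ℝ) : ℂ), ((1 - Δ - k j : ℝ) : ℂ), ((1 - Δ - m j : ℝ) : ℂ)]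
            ![((Θ : ℝ) : ℂ), ((-Θ : ℝ) : ℂ)] ((C / s : ℝ) : ℂ)) s := by
  have hm0 (c : Channel) : 0 < m c := lt_of_lt_of_le (by norm_num) (hm c)
  have hΩ0 (c : Channel) : 0 < Ω c := by rw [hΩ]; exact Real.rpow_pos_of_pos (hd c) _
  have hki := hk i
  have hkj := hk j
  have hmi := hm0 i
  have hmj := hm0 j
  have hΩi := hΩ0 i
  have hΩj := hΩ0 j
  have hC0 : 0 < C := by rw [hC]; positivity
  have hsum : Δ + Θ = k i := by rw [hΔ, hΘ, halfSum, halfDiff]; ring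
  have hdiff : Δ - Θ = m i := by rw [hΔ, hΘ, halfSum, halfDiff]; ring
  set X : S → ℝ := hopSNR h w N₀ l with hX
  have hXeq : X = fun x => w * ‖h i x‖ ^ 2 / (N₀ * ‖h j x‖ ^ 2) := by
    rw [hX, hi, hj]; rfl
  have hXm : AEMeasurable X μ := by
    have h1 := (hlaw i).aemeasurable
    have h2 := (hlaw j).aemeasurable
    rw [hXeq]
    fun_prop
  set ν : Measure ℝ := μ.map X with hν
  have : IsProbabilityMeasure ν := Measure.isProbabilityMeasure_map hXm
  have hpos : ∀ᵐ v ∂ν, 0 < v := by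
    refine (ae_map_iff hXm measurableSet_Ioi).2 ?_
    filter_upwards [HasLaw.ae_pos_generalizedK (hlaw i), HasLaw.ae_pos_generalizedK (hlaw j)]
      with x h1 h2
    rw [hXeq]
    positivity
  have hmgf : negMGF X μ = fun u => ∫ v, Real.exp (-u * v) ∂ν := by
    ext u
    rw [hν, integral_map hXm (by fun_prop)]
    rfl
  have hex : ∃ σ : ℝ, SeparatesPoles 2 3
      ![((-Δ : ℝ) : ℂ), ((1 - Δ - k j : ℝ) : ℂ), ((1 - Δ - m j : ℝ) : ℂ)]
      ![((Θ : ℝ) : ℂ), ((-Θ : ℝ) : ℂ)] σ := by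
    -- On `Re t = -Δ` the moment exponent `-(Δ + t)` has real part `0`; separation then reduces to
    -- positivity of the shape parameters.
    refine ⟨-Δ, separatesPoles_two_three_iff.2 ?_⟩
    simp only [Complex.ofReal_re]
    refine ⟨⟨?_, ?_, ?_⟩, ?_, ?_⟩ <;> linarith
  rw [meijerG, dif_pos hex]
  set σ := hex.choose with hσ
  obtain ⟨⟨h1, h2, h3⟩, h4, h5⟩ := separatesPoles_two_three_iff.1 (hσ ▸ hex.choose_spec)
  simp only [Complex.ofReal_re] at h1 h2 h3 h4 h5
  have hre (y : ℝ) : (1 - (((1 + Δ + σ : ℝ) : ℂ) + y * Complex.I)).re = -(Δ + σ) := by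
    simp; ring
  -- The inversion line is the chosen separating line shifted by `1 + Δ`. Of the five separation
  -- inequalities, `h1` makes it admissible and the other four make the moment finite.
  have hτ : 0 < 1 + Δ + σ := by linarith
  have hcpow : Measurable fun v : ℝ => (v : ℂ) ^ ((1 - (1 + Δ + σ) : ℝ) : ℂ) := by fun_prop
  have hint : Integrable (fun v : ℝ => (v : ℂ) ^ ((1 - (1 + Δ + σ) : ℝ) : ℂ)) ν := by
    refine (integrable_map_measure hcpow.aestronglyMeasurable hXm).2 ?_
    rw [hXeq]
    refine integrable_ratio_cpow hmi hki hΩi hmj hkj hΩj hw hN₀ (hlaw i) (hlaw j) hindep ?_ ?_ ?_ ?_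
      <;> rw [Complex.ofReal_re] <;> linarith
  have hderiv := (hasDerivAt_integral_exp_neg hpos hs).ofReal_comp
  rw [hmgf]
  refine hderiv.congr_deriv ?_
  rw [Complex.ofReal_neg, integral_mul_exp_neg_eq hpos hs hτ hint, neg_mul, mul_left_comm]
  congr 2
  rw [← integral_const_mul]
  refine integral_congr_ae (.of_forall fun y => ?_)
  beta_reduce
  rw [hν, integral_map hXm
    (by fun_prop : Measurable fun v : ℝ => (v : ℂ) ^
      (1 - (((1 + Δ + σ : ℝ) : ℂ) + y * Complex.I))).aestronglyMeasurable, hXeq,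
    integral_ratio_cpow hmi hki hΩi hmj hkj hΩj hw hN₀ (hlaw i) (hlaw j) hindep
      (by rw [hre]; linarith) (by rw [hre]; linarith) (by rw [hre]; linarith)
      (by rw [hre]; linarith), ← hC, meijerGIntegrand_two_three]
  -- The integrands now agree pointwise: the moment exponent is `-(Δ + t)`, and `k i = Δ + Θ`, `m i
  -- = Δ - Θ` turn the Gamma arguments into the Meijer ones.
  set t : ℂ := σ + y * Complex.I with ht
  have hsC : (s : ℂ) ≠ 0 := by exact_mod_cast hs.ne'
  have hCC : (C : ℂ) ≠ 0 := by exact_mod_cast hC0.ne'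
  have e1 : ((1 + Δ + σ : ℝ) : ℂ) + y * Complex.I = 1 + Δ + t := by rw [ht]; push_cast; ring
  have e2 : (m i : ℂ) + (1 - (1 + Δ + t)) = ((-Θ : ℝ) : ℂ) - t := by
    rw [← hdiff]; push_cast; ring
  have e3 : (k i : ℂ) + (1 - (1 + Δ + t)) = Θ - t := by rw [← hsum]; push_cast; ring
  have e4 : (m j : ℂ) - (1 - (1 + Δ + t)) = 1 - ((1 - Δ - m j : ℝ) : ℂ) + t := by push_cast; ring
  have e5 : (k j : ℂ) - (1 - (1 + Δ + t)) = 1 - ((1 - Δ - k j : ℝ) : ℂ) + t := by push_cast; ring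
  have e6 : 1 - ((-Δ : ℝ) : ℂ) + t = 1 + Δ + t := by push_cast; ring
  have e7 : (C : ℂ) ^ (-(1 - (1 + Δ + t))) = (C : ℂ) ^ (Δ : ℂ) * (C : ℂ) ^ t := by
    rw [← Complex.cpow_add _ _ hCC]; congr 1; ring
  have e8 : (s : ℂ) ^ (-(1 + Δ + t)) = ((s : ℂ) ^ ((Δ + 1 : ℝ) : ℂ))⁻¹ * ((s : ℂ) ^ t)⁻¹ := by
    rw [← Complex.cpow_neg, ← Complex.cpow_neg, ← Complex.cpow_add _ _ hsC]
    congr 1; push_cast; ring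
  have e9 : ((C / s : ℝ) : ℂ) ^ t = (C : ℂ) ^ t * ((s : ℂ) ^ t)⁻¹ := by
    rw [div_eq_mul_inv, Complex.ofReal_mul, Complex.mul_cpow_ofReal_nonneg hC0.le
      (by positivity), Complex.ofReal_inv, Complex.inv_cpow]
    rw [Complex.arg_ofReal_of_nonneg hs.le]
    exact Real.pi_ne_zero.symm
  have e10 : ((C ^ Δ / (Real.Gamma (m i) * Real.Gamma (m j) * Real.Gamma (k i) * Real.Gamma (k j)
      * s ^ (Δ + 1)) : ℝ) : ℂ) = (C : ℂ) ^ (Δ : ℂ) / (Complex.Gamma (m i) * Complex.Gamma (m j) *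
        Complex.Gamma (k i) * Complex.Gamma (k j) * (s : ℂ) ^ ((Δ + 1 : ℝ) : ℂ)) := by
    simp only [Complex.ofReal_div, Complex.ofReal_mul, Complex.ofReal_cpow hC0.le,
      Complex.ofReal_cpow hs.le, Complex.Gamma_ofReal]
  rw [e1, e2, e3, e4, e5, e6, e7, e8, e9, e10]
  ring
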